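/- **The bond percolation game.** Consider the lattice $\mathbb{Z}^2$ with all directed edges $\big((x,y),(x+1,y)\big)$ and $\big((x,y),(x,y+1)\big)$, $(x,y)\in\mathbb{Z}^2$. Let $\Theta'=\{(r',s')\in[0,1]^2 : 0<r'+s'\le 1\}$ and $(r',s')\in\Theta'$. Each directed edge receives, independently of all other edges, the label *trap* with probability $r'$, *target* with probability $s'$, and *open* with probability $1-r'-s'$; the labels are fixed before the game begins and are known to both players. A token is placed at an initial vertex. Two players take turns; a move takes the token from its current position $(x,y)$ along a directed edge to $(x+1,y)$ or to $(x,y+1)$. A player who moves the token along a target wins, a player who moves it along a trap loses, and in both cases the game ends; it continues as long as the token is moved along open edges. For a given labelling and a given initial vertex, the game results in a *draw* if neither player has a strategy that guarantees a win after finitely many moves. **Theorem 2.** (B1) There exist $\epsilon_1,\epsilon_2\in(0,1)$ such that, for every $(r',s')\in\Theta'$ with $r'\le\epsilon_1$, $s'\le\epsilon_2$ and $$\frac{3(2s'-s'^2)^2}{2}+\frac{8(2s'-s'^2)r'}{1-s'}+\frac{11r'^2}{2(1-s')^2}\ \ge\ \frac{2r'}{1-s'}+\frac{9(2s'-s'^2)^3}{2}+\frac{16(2s'-s'^2)^2r'}{1-s'}+\frac{43(2s'-s'^2)r'^2}{2(1-s')^2}+\frac{5r'^3}{(1-s')^3},$$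 the probability that the bond percolation game with parameters $r',s'$ results in a draw is $0$, for every initial vertex. (B2) If $(r',s')\in\Theta'$, $s'=0$ and $r'>0.157175$, the probability that the bond percolation game with parameters $r',s'$ results in a draw is $0$, for every initial vertex. (B3) If $(r',s')\in\Theta'$ and $r'=s'\ge 0.10883$, the probability that the bond percolation game with parameters $r',s'$ results in a draw is $0$, for every initial vertex. -/

import Mathlib

open MeasureTheory

namespace BondGame

/-- The possible labels of a directed edge. -/
inductive Label
  | trap
  | target
  | opn

instance : MeasurableSpace Label := ⊤

/-- The two possible moves of the token: `right` goes from `(x, y)` to `(x + 1, y)`,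
`up` goes from `(x, y)` to `(x, y + 1)`. -/
inductive Dir
  | right
  | up

/-- The endpoint of the directed edge that starts at `v` and has direction `d`. -/
def step (v : ℤ × ℤ) : Dir → ℤ × ℤ
  | Dir.right => (v.1 + 1, v.2)
  | Dir.up => (v.1, v.2 + 1)

/-- A directed edge of the square lattice: its starting vertex together with its direction. -/
abbrev Edge : Type := (ℤ × ℤ) × Dir

/-- A configuration: a label for every directed edge. -/
abbrev Config : Type := Edge → Label

/-! ### The game on a fixed configuration

A play is recorded as an infinite sequence of moves `m : ℕ → Dir`; move number `n` is made by the
first player if `n` is even and by the second player if `n` is odd. The game is over as soon as the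
token has been moved along an edge that is not open, and later entries of `m` are irrelevant. -/

/-- The position of the token before move number `n`, when it starts at `v`. -/
def pos (v : ℤ × ℤ) (m : ℕ → Dir) : ℕ → ℤ × ℤ
  | 0 => v
  | n + 1 => step (pos v m n) (m n)

/-- The edge along which the token is moved in move number `n`. -/
def edgeAt (v : ℤ × ℤ) (m : ℕ → Dir) (n : ℕ) : Edge := (pos v m n, m n)

/-- Move number `n` ends the game in favour of the player who makes it: the game has not ended
before, and the move is along a target. -/
def MoverWinsAt (η : Config) (v : ℤ × ℤ) (m : ℕ → Dir) (n : ℕ) : Prop :=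
  (∀ k < n, η (edgeAt v m k) = Label.opn) ∧ η (edgeAt v m n) = Label.target

/-- Move number `n` ends the game in favour of the opponent of the player who makes it: the game
has not ended before, and the move is along a trap. -/
def MoverLosesAt (η : Config) (v : ℤ × ℤ) (m : ℕ → Dir) (n : ℕ) : Prop :=
  (∀ k < n, η (edgeAt v m k) = Label.opn) ∧ η (edgeAt v m n) = Label.trap

/-- The play `m` is won by the first player. -/
def FirstWinsPlay (η : Config) (v : ℤ × ℤ) (m : ℕ → Dir) : Prop :=
  ∃ n, (Even n ∧ MoverWinsAt η v m n) ∨ (Odd n ∧ MoverLosesAt η v m n)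

/-- The play `m` is won by the second player. -/
def SecondWinsPlay (η : Config) (v : ℤ × ℤ) (m : ℕ → Dir) : Prop :=
  ∃ n, (Odd n ∧ MoverWinsAt η v m n) ∨ (Even n ∧ MoverLosesAt η v m n)

/-- A strategy chooses a move as a function of the list of all previous moves. It may depend on
the configuration and on the initial vertex, which both players know. -/
abbrev Strategy : Type := List Dir → Dir

/-- The list of the moves made before move number `n`. -/
def history (m : ℕ → Dir) (n : ℕ) : List Dir := (List.range n).map m

/-- The first player has a winning strategy from the initial vertex `v`. -/
def FirstWins (η : Config) (v : ℤ × ℤ) : Prop :=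
  ∃ σ : Strategy, ∀ m : ℕ → Dir,
    (∀ n, Even n → m n = σ (history m n)) → FirstWinsPlay η v m

/-- The second player has a winning strategy from the initial vertex `v`. -/
def SecondWins (η : Config) (v : ℤ × ℤ) : Prop :=
  ∃ σ : Strategy, ∀ m : ℕ → Dir,
    (∀ n, Odd n → m n = σ (history m n)) → SecondWinsPlay η v m

/-- The game with initial vertex `v` results in a draw: neither player can force a win. -/
def IsDraw (η : Config) (v : ℤ × ℤ) : Prop :=
  ¬ FirstWins η v ∧ ¬ SecondWins η v

/-! ### The random board -/

/-- The parameter space: `r` is the probability of a trap, `s` that of a target. -/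
def paramSpace : Set (ℝ × ℝ) :=
  {q | q.1 ∈ Set.Icc 0 1 ∧ q.2 ∈ Set.Icc 0 1 ∧ 0 < q.1 + q.2 ∧ q.1 + q.2 ≤ 1}

/-- The law of the label of one edge. -/
noncomputable def labelLaw (r s : ℝ) : Measure Label :=
  ENNReal.ofReal r • Measure.dirac Label.trap
    + ENNReal.ofReal s • Measure.dirac Label.target
    + ENNReal.ofReal (1 - r - s) • Measure.dirac Label.opn

theorem isProbabilityMeasure_labelLaw {r s : ℝ} (h : (r, s) ∈ paramSpace) :
    IsProbabilityMeasure (labelLaw r s) := by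
  obtain ⟨⟨hr, -⟩, ⟨hs, -⟩, -, h1⟩ := h
  simp only at hr hs h1
  refine ⟨?_⟩
  simp only [labelLaw, Measure.add_apply, Measure.smul_apply, measure_univ, smul_eq_mul, mul_one]
  rw [← ENNReal.ofReal_add hr hs, ← ENNReal.ofReal_add (by linarith) (by linarith)]
  simp

/-- The law of the random configuration: the labels of the edges are independent, and each of them
has law `labelLaw r s`. -/
noncomputable def boardLaw (r s : ℝ) : Measure Config :=
  Measure.infinitePi fun _ : Edge => labelLaw r s

/-- The probability that the bond percolation game with parameters `r`, `s` and initial vertex `v`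
results in a draw. -/
noncomputable def drawProb (r s : ℝ) (v : ℤ × ℤ) : ENNReal :=
  boardLaw r s {η | IsDraw η v}

end BondGame

/-! Call a position a win, a loss or a draw for the player about to move. Its status is a function
of the labels of its two outgoing edges and of the statuses of its two successors. Hence the
statuses on an antidiagonal arise from those on the next one by a probabilistic cellular automaton
with fresh independent labels, and the field of statuses is translation invariant because the board
is.

The method is a weight function. Let `w` be a function of three neighbouring statuses on an
antidiagonal. By translation invariance its mean is the same on consecutive antidiagonals, so `w`
minus its conditional expectation after one step of the automaton has mean zero (`integral_drift`).
A telescoping flux `g` may be added, and the result may be symmetrized under reversal of the window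
(`drift_reverse`), without changing this. If the resulting function of four statuses is nonnegative,
and at least `κ > 0` whenever the first status is a draw, then `κ` times the probability of a draw
is at most zero (`drawProb_eq_zero_of_drift`).

Each parameter region then only needs an explicit potential and flux, for which 81 polynomial
inequalities are checked, one for each window. -/

namespace BondGame

/-! ### Outcomes of positions on a fixed configuration -/

/-- The outcome of the game for the player who is about to move. -/
inductive Status
  | win
  | loss
  | draw
  deriving DecidableEq

instance : Fintype Status where
  elems := {Status.win, Status.loss, Status.draw}
  complete x := by cases x <;> simp

/-- What a move along an edge with the given label amounts to, as seen by the opponent, when the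
endpoint of the edge has the given status. -/
def effective : Label → Status → Status
  | Label.trap, _ => Status.win
  | Label.target, _ => Status.loss
  | Label.opn, a => a

/-- The status of a position from those of the two positions the player can pass on. -/
def resolve : Status → Status → Status
  | Status.loss, _ => Status.win
  | _, Status.loss => Status.win
  | Status.win, Status.win => Status.loss
  | _, _ => Status.draw

/-- The status of `v` as far as it is decided within `n` moves. -/
def statusIn (η : Config) : ℕ → ℤ × ℤ → Status
  | 0, _ => Status.draw
  | n + 1, v =>
    resolve (effective (η (v, Dir.right)) (statusIn η n (step v Dir.right)))
      (effective (η (v, Dir.up)) (statusIn η n (step v Dir.up)))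

/-- A draw here means "undecided": an outcome already decided with some inputs undecided survives
any later decision of those inputs. -/
theorem resolve_effective_stable {a b a' b' : Status} (l l' : Label)
    (ha : a ≠ Status.draw → a' = a) (hb : b ≠ Status.draw → b' = b)
    (h : resolve (effective l a) (effective l' b) ≠ Status.draw) :
    resolve (effective l a') (effective l' b') = resolve (effective l a) (effective l' b) := by
  cases l <;> cases l' <;> cases a <;> cases b <;> simp_all [resolve, effective] <;>
    cases a' <;> simp_all

theorem statusIn_succ_of_ne_draw (η : Config) (n : ℕ) (v : ℤ × ℤ)
    (h : statusIn η n v ≠ Status.draw) : statusIn η (n + 1) v = statusIn η n v := by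
  induction n generalizing v with
  | zero => exact absurd rfl h
  | succ n ih => exact resolve_effective_stable _ _ (ih _) (ih _) h

theorem statusIn_of_le (η : Config) {n k : ℕ} (hnk : n ≤ k) (v : ℤ × ℤ)
    (h : statusIn η n v ≠ Status.draw) : statusIn η k v = statusIn η n v := by
  induction k, hnk using Nat.le_induction with
  | base => rfl
  | succ k _ ih => rw [statusIn_succ_of_ne_draw η k v (by rwa [ih]), ih]

open Classical in
/-- The status of the position `v`. -/
noncomputable def status (η : Config) (v : ℤ × ℤ) : Status :=
  if ∃ n, statusIn η n v = Status.win then Status.win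
  else if ∃ n, statusIn η n v = Status.loss then Status.loss
  else Status.draw

theorem exists_forall_statusIn_eq (η : Config) (v : ℤ × ℤ) :
    ∃ n, ∀ k ≥ n, statusIn η k v = status η v := by
  unfold status
  split_ifs with h₁ h₂
  · obtain ⟨n, hn⟩ := h₁
    exact ⟨n, fun k hk => by rw [statusIn_of_le η hk v (by simp [hn]), hn]⟩
  · obtain ⟨n, hn⟩ := h₂
    exact ⟨n, fun k hk => by rw [statusIn_of_le η hk v (by simp [hn]), hn]⟩
  · refine ⟨0, fun k _ => ?_⟩
    cases h : statusIn η k v with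
    | win => exact absurd ⟨k, h⟩ h₁
    | loss => exact absurd ⟨k, h⟩ h₂
    | draw => rfl

theorem status_eq_resolve (η : Config) (v : ℤ × ℤ) :
    status η v = resolve (effective (η (v, Dir.right)) (status η (step v Dir.right)))
      (effective (η (v, Dir.up)) (status η (step v Dir.up))) := by
  obtain ⟨n₀, h₀⟩ := exists_forall_statusIn_eq η v
  obtain ⟨n₁, h₁⟩ := exists_forall_statusIn_eq η (step v Dir.right)
  obtain ⟨n₂, h₂⟩ := exists_forall_statusIn_eq η (step v Dir.up)
  -- All three statuses have stabilized at these levels; the one extra level for `v` makes the claim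
  -- the recursion of `statusIn`.
  rw [← h₀ (n₀ + n₁ + n₂ + 1) (by omega), ← h₁ (n₀ + n₁ + n₂) (by omega),
    ← h₂ (n₀ + n₁ + n₂) (by omega)]
  rfl

/-! ### Decided positions have winning strategies -/

theorem pos_succ_eq (v : ℤ × ℤ) (m : ℕ → Dir) (n : ℕ) :
    pos v m (n + 1) = pos (step v (m 0)) (fun k => m (k + 1)) n := by
  induction n with
  | zero => rfl
  | succ n ih => rw [pos, ih]; rfl

theorem edgeAt_succ_eq (v : ℤ × ℤ) (m : ℕ → Dir) (n : ℕ) :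
    edgeAt v m (n + 1) = edgeAt (step v (m 0)) (fun k => m (k + 1)) n := by
  simp only [edgeAt, pos_succ_eq]

theorem history_succ_eq (m : ℕ → Dir) (n : ℕ) :
    history m (n + 1) = m 0 :: history (fun k => m (k + 1)) n := by
  simp [history, List.range_succ_eq_map, Function.comp_def]

theorem moverWinsAt_succ {η : Config} {v : ℤ × ℤ} {m : ℕ → Dir} {n : ℕ}
    (h₀ : η (v, m 0) = Label.opn)
    (h : MoverWinsAt η (step v (m 0)) (fun k => m (k + 1)) n) : MoverWinsAt η v m (n + 1) := by
  refine ⟨fun k hk => ?_, by rw [edgeAt_succ_eq]; exact h.2⟩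
  cases k with
  | zero => exact h₀
  | succ k => rw [edgeAt_succ_eq]; exact h.1 k (by omega)

theorem moverLosesAt_succ {η : Config} {v : ℤ × ℤ} {m : ℕ → Dir} {n : ℕ}
    (h₀ : η (v, m 0) = Label.opn)
    (h : MoverLosesAt η (step v (m 0)) (fun k => m (k + 1)) n) : MoverLosesAt η v m (n + 1) := by
  refine ⟨fun k hk => ?_, by rw [edgeAt_succ_eq]; exact h.2⟩
  cases k with
  | zero => exact h₀
  | succ k => rw [edgeAt_succ_eq]; exact h.1 k (by omega)

theorem firstWins_of_target {η : Config} {v : ℤ × ℤ} {d : Dir} (h : η (v, d) = Label.target) :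
    FirstWins η v := by
  refine ⟨fun _ => d, fun m hm => ⟨0, Or.inl ⟨Even.zero, fun k hk => by omega, ?_⟩⟩⟩
  rw [edgeAt, hm 0 Even.zero]
  exact h

theorem firstWins_of_opn {η : Config} {v : ℤ × ℤ} {d : Dir} (h : η (v, d) = Label.opn)
    (hd : SecondWins η (step v d)) : FirstWins η v := by
  obtain ⟨σ, hσ⟩ := hd
  -- After the move `d` the roles swap: the first player follows `σ` on the history without its
  -- first entry.
  refine ⟨fun l => match l with
    | [] => d
    | _ :: t => σ t, fun m hm => ?_⟩
  have h0 : m 0 = d := hm 0 Even.zero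
  have hplay := hσ (fun k => m (k + 1)) fun n hn => by
    have := hm (n + 1) hn.add_one
    rwa [history_succ_eq] at this
  rw [← h0] at h hplay
  obtain ⟨n, ⟨hn, hw⟩ | ⟨hn, hl⟩⟩ := hplay
  · exact ⟨n + 1, Or.inl ⟨hn.add_one, moverWinsAt_succ h hw⟩⟩
  · exact ⟨n + 1, Or.inr ⟨hn.add_one, moverLosesAt_succ h hl⟩⟩

theorem secondWins_of_forall {η : Config} {v : ℤ × ℤ}
    (h : ∀ d, η (v, d) = Label.trap ∨ (η (v, d) = Label.opn ∧ FirstWins η (step v d))) :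
    SecondWins η v := by
  have h' : ∀ d, ∃ σ : Strategy, η (v, d) = Label.trap ∨ (η (v, d) = Label.opn ∧
      ∀ m : ℕ → Dir, (∀ n, Even n → m n = σ (history m n)) → FirstWinsPlay η (step v d) m) := by
    intro d
    obtain ht | ⟨ho, σ, hσ⟩ := h d
    -- The strategy is arbitrary, since the trap ends the game at once.
    · exact ⟨fun _ => d, Or.inl ht⟩
    · exact ⟨σ, Or.inr ⟨ho, hσ⟩⟩
  choose σ hσ using h'
  -- The value at `[]` is never used: the second player always sees a nonempty history, whose head
  -- selects the strategy.
  refine ⟨fun l => match l with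
    | [] => Dir.up
    | d :: t => σ d t, fun m hm => ?_⟩
  obtain ht | ⟨ho, hplay⟩ := hσ (m 0)
  · exact ⟨0, Or.inr ⟨Even.zero, fun k hk => by omega, ht⟩⟩
  · specialize hplay (fun k => m (k + 1)) fun n hn => by
      have := hm (n + 1) hn.add_one
      rwa [history_succ_eq] at this
    obtain ⟨n, ⟨hn, hw⟩ | ⟨hn, hl⟩⟩ := hplay
    · exact ⟨n + 1, Or.inl ⟨hn.add_one, moverWinsAt_succ ho hw⟩⟩
    · exact ⟨n + 1, Or.inr ⟨hn.add_one, moverLosesAt_succ ho hl⟩⟩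

theorem resolve_eq_win {a b : Status} (h : resolve a b = Status.win) :
    a = Status.loss ∨ b = Status.loss := by
  cases a <;> cases b <;> simp_all [resolve]

theorem resolve_eq_loss {a b : Status} (h : resolve a b = Status.loss) :
    a = Status.win ∧ b = Status.win := by
  cases a <;> cases b <;> simp_all [resolve]

theorem effective_eq_loss {l : Label} {a : Status} (h : effective l a = Status.loss) :
    l = Label.target ∨ (l = Label.opn ∧ a = Status.loss) := by
  cases l <;> simp_all [effective]

theorem effective_eq_win {l : Label} {a : Status} (h : effective l a = Status.win) :
    l = Label.trap ∨ (l = Label.opn ∧ a = Status.win) := by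
  cases l <;> simp_all [effective]

theorem wins_of_statusIn (η : Config) (n : ℕ) (v : ℤ × ℤ) :
    (statusIn η n v = Status.win → FirstWins η v) ∧
      (statusIn η n v = Status.loss → SecondWins η v) := by
  induction n generalizing v with
  | zero => exact ⟨fun h => (by cases h), fun h => (by cases h)⟩
  | succ n ih =>
    have key : ∀ d, effective (η (v, d)) (statusIn η n (step v d)) = Status.loss →
        FirstWins η v := fun d h => by
      obtain h | ⟨h, h'⟩ := effective_eq_loss h
      · exact firstWins_of_target h
      · exact firstWins_of_opn h ((ih _).2 h')
    refine ⟨fun h => ?_, fun h => secondWins_of_forall fun d => ?_⟩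
    · obtain h | h := resolve_eq_win h
      · exact key _ h
      · exact key _ h
    · have h' : effective (η (v, d)) (statusIn η n (step v d)) = Status.win := by
        cases d
        · exact (resolve_eq_loss h).1
        · exact (resolve_eq_loss h).2
      exact (effective_eq_win h').imp_right fun h => ⟨h.1, (ih _).1 h.2⟩

theorem status_eq_draw_of_isDraw {η : Config} {v : ℤ × ℤ} (h : IsDraw η v) :
    status η v = Status.draw := by
  obtain ⟨n, hn⟩ := exists_forall_statusIn_eq η v
  rw [← hn n le_rfl]
  cases hs : statusIn η n v with
  | win => exact absurd ((wins_of_statusIn η n v).1 hs) h.1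
  | loss => exact absurd ((wins_of_statusIn η n v).2 hs) h.2
  | draw => rfl

/-! ### Measurability of the status -/

instance : MeasurableSpace Status := ⊤

instance : MeasurableSingletonClass Status := ⟨fun _ => trivial⟩

instance : MeasurableSingletonClass Label := ⟨fun _ => trivial⟩

instance : Finite Label :=
  Set.finite_univ_iff.1 <| Set.Finite.subset
    (s := {Label.trap, Label.target, Label.opn}) (by simp) fun x _ => by cases x <;> simp

/-- The σ-algebra generated by the labels of the edges that do not start at `u`. -/
@[reducible]
def awayFrom (u : ℤ × ℤ) : MeasurableSpace Config :=
  ⨆ e ∈ {e : Edge | e.1 ≠ u}, MeasurableSpace.comap (fun η : Config => η e) inferInstance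

theorem awayFrom_le (u : ℤ × ℤ) : awayFrom u ≤ (inferInstance : MeasurableSpace Config) :=
  iSup₂_le fun e _ => (measurable_pi_apply e).comap_le

theorem measurable_label_awayFrom {u : ℤ × ℤ} {e : Edge} (h : e.1 ≠ u) :
    Measurable[awayFrom u] fun η : Config => η e :=
  (comap_measurable _).mono (le_iSup₂_of_le e h le_rfl) le_rfl

/-- Each move raises the coordinate sum by one, so play from `z` never visits `u` and never reads an
edge starting there. This is the source of all independence below. -/
theorem measurable_statusIn {u z : ℤ × ℤ} (hne : z ≠ u) (hle : u.1 + u.2 ≤ z.1 + z.2) (n : ℕ) :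
    Measurable[awayFrom u] fun η => statusIn η n z := by
  induction n generalizing z with
  | zero => exact @measurable_const _ _ _ (awayFrom u) Status.draw
  | succ n ih =>
    have hd : ∀ d, Measurable[awayFrom u] fun η => statusIn η n (step z d) := fun d => by
      refine ih (fun h => ?_) ?_ <;> cases d <;> simp only [step] at * <;> first | omega | skip
      all_goals subst h; simp only at hle; omega
    have h := fun d => (measurable_label_awayFrom (u := u) (e := (z, d)) hne).prodMk (hd d)
    exact (measurable_of_countable fun x : (Label × Status) × (Label × Status) =>
      resolve (effective x.1.1 x.1.2) (effective x.2.1 x.2.2)).comp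
        ((h Dir.right).prodMk (h Dir.up))

theorem status_eq_iff_exists (η : Config) (v : ℤ × ℤ) {a : Status} (ha : a ≠ Status.draw) :
    status η v = a ↔ ∃ n, statusIn η n v = a := by
  obtain ⟨n, hn⟩ := exists_forall_statusIn_eq η v
  refine ⟨fun h => ⟨n, by rw [hn n le_rfl, h]⟩, fun ⟨k, hk⟩ => ?_⟩
  rw [← hn (n + k) (by omega), statusIn_of_le η (Nat.le_add_left k n) v (by rwa [hk]), hk]

theorem measurable_status_awayFrom {u z : ℤ × ℤ} (hne : z ≠ u)
    (hle : u.1 + u.2 ≤ z.1 + z.2) : Measurable[awayFrom u] fun η => status η z := by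
  have h : ∀ a ≠ Status.draw, MeasurableSet[awayFrom u] {η | status η z = a} := fun a ha => by
    simp only [status_eq_iff_exists _ _ ha, Set.ofPred_exists]
    exact MeasurableSet.iUnion fun n => measurable_statusIn hne hle n (measurableSet_singleton a)
  refine @measurable_to_countable' _ _ _ _ (awayFrom u) _ fun a => ?_
  by_cases ha : a = Status.draw
  -- Being drawn is not decided at any finite level, so this event is treated as a complement.
  · subst ha
    convert ((h Status.win (by simp)).union (h Status.loss (by simp))).compl using 1
    ext η
    cases hs : status η z <;> simp [hs]
  · exact h a ha

theorem measurable_status (z : ℤ × ℤ) : Measurable fun η => status η z :=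
  (measurable_status_awayFrom (u := (z.1 - 1, z.2)) (fun h => by
    have := congrArg Prod.fst h; simp only at this; omega) (by simp)).mono (awayFrom_le _) le_rfl

/-! ### The transition probabilities -/

/-- The probability that a move to a position of status `a` is losing for the player who makes
it. -/
def lossFactor (r s : ℝ) : Status → ℝ
  | Status.win => 1 - s
  | _ => r

/-- The probability that a move to a position of status `a` is not winning. -/
def nonwinFactor (r s : ℝ) : Status → ℝ
  | Status.loss => r
  | _ => 1 - s

/-- The conditional law of the status of a position, given that its two successors have status
`a` and `b`. -/
def trans (r s : ℝ) (a b : Status) : Status → ℝ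
  | Status.win => 1 - nonwinFactor r s a * nonwinFactor r s b
  | Status.loss => lossFactor r s a * lossFactor r s b
  | Status.draw =>
    nonwinFactor r s a * nonwinFactor r s b - lossFactor r s a * lossFactor r s b

/-- The average of `f` over the conditional law `trans r s a b`. -/
def avg (r s : ℝ) (a b : Status) (f : Status → ℝ) : ℝ :=
  trans r s a b Status.win * f Status.win + trans r s a b Status.loss * f Status.loss
    + trans r s a b Status.draw * f Status.draw

/-- The average of `f` over the statuses of three neighbouring positions, given those of their four
successors. -/
def avg₃ (r s : ℝ) (f : Status → Status → Status → ℝ) (a b c d : Status) : ℝ :=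
  avg r s a b fun x => avg r s b c fun y => avg r s c d fun z => f x y z

theorem avg_comm (r s : ℝ) (a b : Status) (f : Status → ℝ) : avg r s a b f = avg r s b a f := by
  simp only [avg, trans, mul_comm (lossFactor r s a), mul_comm (nonwinFactor r s a)]

theorem avg₃_reverse (r s : ℝ) (f : Status → Status → Status → ℝ) (a b c d : Status) :
    avg₃ r s (fun x y z => f z y x) a b c d = avg₃ r s f d c b a := by
  unfold avg₃
  simp only [avg_comm r s d c, avg_comm r s c b, avg_comm r s b a]
  simp only [avg]
  ring

theorem integral_labelLaw {r s : ℝ} (h : (r, s) ∈ paramSpace) (f : Label → ℝ) :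
    ∫ l, f l ∂labelLaw r s
      = r * f Label.trap + s * f Label.target + (1 - r - s) * f Label.opn := by
  obtain ⟨⟨hr, -⟩, ⟨hs, -⟩, -, h1⟩ := h
  simp only at hr hs h1
  have hi : ∀ (c : ℝ) (l : Label),
      Integrable f (ENNReal.ofReal c • Measure.dirac l) := fun c l =>
    (integrable_dirac (by simp)).smul_measure ENNReal.ofReal_ne_top
  rw [labelLaw, integral_add_measure ((hi _ _).add_measure (hi _ _)) (hi _ _),
    integral_add_measure (hi _ _) (hi _ _)]
  simp only [integral_smul_measure, integral_dirac, smul_eq_mul, ENNReal.toReal_ofReal hr,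
    ENNReal.toReal_ofReal hs, ENNReal.toReal_ofReal (show 0 ≤ 1 - r - s by linarith)]

theorem integral_resolve {r s : ℝ} (h : (r, s) ∈ paramSpace) (a b : Status) (f : Status → ℝ) :
    ∫ l : Label × Label, f (resolve (effective l.1 a) (effective l.2 b))
      ∂(labelLaw r s).prod (labelLaw r s) = avg r s a b f := by
  have := isProbabilityMeasure_labelLaw h
  rw [integral_prod _ Integrable.of_finite]
  simp only [integral_labelLaw h]
  cases a <;> cases b <;>
    simp only [effective, resolve, avg, trans, lossFactor, nonwinFactor] <;> ring

/-! ### The law of the field of statuses -/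

theorem isProbabilityMeasure_boardLaw {r s : ℝ} (h : (r, s) ∈ paramSpace) :
    IsProbabilityMeasure (boardLaw r s) := by
  have := isProbabilityMeasure_labelLaw h
  unfold boardLaw
  infer_instance

/-- The pair of labels of the edges that start at `u`. -/
def labelsAt (u : ℤ × ℤ) (η : Config) : Label × Label := (η (u, Dir.right), η (u, Dir.up))

theorem measurable_labelsAt (u : ℤ × ℤ) : Measurable (labelsAt u) :=
  (measurable_pi_apply _).prodMk (measurable_pi_apply _)

theorem map_labelsAt {r s : ℝ} (h : (r, s) ∈ paramSpace) (u : ℤ × ℤ) :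
    (boardLaw r s).map (labelsAt u) = (labelLaw r s).prod (labelLaw r s) := by
  have := isProbabilityMeasure_labelLaw h
  exact Measure.infinitePi_map_eval_prod (P := fun _ : Edge => labelLaw r s)
    (i := (u, Dir.right)) (j := (u, Dir.up)) (by simp)

theorem indepFun_labelsAt {r s : ℝ} (h : (r, s) ∈ paramSpace) (u : ℤ × ℤ) {β : Type*}
    [MeasurableSpace β] {Z : Config → β} (hZ : Measurable[awayFrom u] Z) :
    ProbabilityTheory.IndepFun Z (labelsAt u) (boardLaw r s) := by
  have := isProbabilityMeasure_labelLaw h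
  have hind : ProbabilityTheory.iIndep
      (fun e : Edge => MeasurableSpace.comap (fun η : Config => η e) inferInstance)
      (boardLaw r s) :=
    ProbabilityTheory.iIndepFun_infinitePi (P := fun _ : Edge => labelLaw r s)
      (X := fun _ l => l) fun _ => measurable_id
  have hdis : Disjoint {e : Edge | e.1 ≠ u} {e : Edge | e.1 = u} :=
    Set.disjoint_left.2 fun e h h' => h h'
  have := ProbabilityTheory.indep_iSup_of_disjoint
    (fun e => (measurable_pi_apply e).comap_le) hind hdis
  rw [ProbabilityTheory.IndepFun_iff_Indep]
  refine ProbabilityTheory.indep_of_indep_of_le_left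
    (ProbabilityTheory.indep_of_indep_of_le_right this ?_) hZ.comap_le
  have hl : ∀ d, Measurable[⨆ e ∈ {e : Edge | e.1 = u},
      MeasurableSpace.comap (fun η : Config => η e) inferInstance]
      fun η : Config => η (u, d) := fun d =>
    (comap_measurable _).mono (le_iSup₂_of_le (u, d) rfl le_rfl) le_rfl
  exact ((hl Dir.right).prodMk (hl Dir.up)).comap_le

/-- Averaging over the status of one position, given those of its successors and of any positions
that do not precede it. -/
theorem integral_status_eq_avg {r s : ℝ} (h : (r, s) ∈ paramSpace) (u : ℤ × ℤ) {β : Type*}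
    [MeasurableSpace β] [Finite β] [MeasurableSingletonClass β] {Z : Config → β}
    (hZ : Measurable[awayFrom u] Z) {a b : β → Status}
    (ha : ∀ η, status η (step u Dir.right) = a (Z η))
    (hb : ∀ η, status η (step u Dir.up) = b (Z η)) (φ : β → Status → ℝ) :
    ∫ η, φ (Z η) (status η u) ∂boardLaw r s
      = ∫ η, avg r s (a (Z η)) (b (Z η)) (φ (Z η)) ∂boardLaw r s := by
  have := isProbabilityMeasure_labelLaw h
  have := isProbabilityMeasure_boardLaw h
  have hZ' : Measurable Z := hZ.mono (awayFrom_le u) le_rfl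
  have : IsProbabilityMeasure ((boardLaw r s).map Z) :=
    Measure.isProbabilityMeasure_map hZ'.aemeasurable
  have hmap := (ProbabilityTheory.indepFun_iff_map_prod_eq_prod_map_map hZ'.aemeasurable
    (measurable_labelsAt u).aemeasurable).1 (indepFun_labelsAt h u hZ)
  rw [map_labelsAt h] at hmap
  let ψ : β × (Label × Label) → ℝ := fun x =>
    φ x.1 (resolve (effective x.2.1 (a x.1)) (effective x.2.2 (b x.1)))
  have e₁ : ∀ η, φ (Z η) (status η u) = ψ (Z η, labelsAt u η) := fun η => by
    rw [status_eq_resolve, ha, hb]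
    rfl
  simp only [e₁]
  rw [← integral_map (hZ'.prodMk (measurable_labelsAt u)).aemeasurable
    (measurable_of_countable ψ).aestronglyMeasurable, hmap,
    integral_prod _ Integrable.of_finite]
  simp only [ψ, integral_resolve h]
  exact integral_map hZ'.aemeasurable
    (measurable_of_countable fun z => avg r s (a z) (b z) (φ z)).aestronglyMeasurable

/-- The configuration seen from `z`. -/
def shift (z : ℤ × ℤ) (η : Config) : Config := fun e => η (e.1 + z, e.2)

theorem measurePreserving_shift {r s : ℝ} (h : (r, s) ∈ paramSpace) (z : ℤ × ℤ) :
    MeasurePreserving (shift z) (boardLaw r s) (boardLaw r s) := by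
  have := isProbabilityMeasure_labelLaw h
  refine ⟨measurable_pi_lambda _ fun e => measurable_pi_apply _, ?_⟩
  exact Measure.map_infinitePi_infinitePi_of_inj (P := fun _ : Edge => labelLaw r s)
    (f := fun e : Edge => (e.1 + z, e.2)) fun e e' hee => by
      simp only [Prod.mk.injEq, add_left_inj] at hee
      exact Prod.ext hee.1 hee.2

theorem step_add (v z : ℤ × ℤ) (d : Dir) : step (v + z) d = step v d + z := by
  cases d <;> ext <;> simp [step] <;> ring

theorem statusIn_shift (z : ℤ × ℤ) (η : Config) (n : ℕ) (v : ℤ × ℤ) :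
    statusIn (shift z η) n v = statusIn η n (v + z) := by
  induction n generalizing v with
  | zero => rfl
  | succ n ih => simp only [statusIn, ih, shift, step_add]

theorem status_shift (z : ℤ × ℤ) (η : Config) (v : ℤ × ℤ) :
    status (shift z η) v = status η (v + z) := by
  obtain ⟨n, hn⟩ := exists_forall_statusIn_eq (shift z η) v
  obtain ⟨k, hk⟩ := exists_forall_statusIn_eq η (v + z)
  rw [← hn (n + k) (by omega), ← hk (n + k) (by omega), statusIn_shift]

theorem measurable_comp_status₃ (f : Status → Status → Status → ℝ) (x y z : ℤ × ℤ) :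
    Measurable fun η => f (status η x) (status η y) (status η z) :=
  (measurable_of_countable fun t : Status × Status × Status => f t.1 t.2.1 t.2.2).comp
    ((measurable_status x).prodMk ((measurable_status y).prodMk (measurable_status z)))

theorem integral_status_translate {r s : ℝ} (h : (r, s) ∈ paramSpace)
    (f : Status → Status → Status → ℝ) (x y z t : ℤ × ℤ) :
    ∫ η, f (status η (x + t)) (status η (y + t)) (status η (z + t)) ∂boardLaw r s
      = ∫ η, f (status η x) (status η y) (status η z) ∂boardLaw r s := by
  have hp := measurePreserving_shift h t
  simp only [← status_shift]
  rw [← integral_map (f := fun η => f (status η x) (status η y) (status η z))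
    hp.measurable.aemeasurable (measurable_comp_status₃ f x y z).aestronglyMeasurable, hp.map_eq]

/-- One step of the automaton: the three positions on the left have the four on the right as
successors. They are averaged out one at a time, each time keeping in `Z` every other status still
needed. -/
theorem integral_status_window {r s : ℝ} (h : (r, s) ∈ paramSpace)
    (f : Status → Status → Status → ℝ) (x y : ℤ) :
    ∫ η, f (status η (x - 1, y)) (status η (x - 2, y + 1)) (status η (x - 3, y + 2)) ∂boardLaw r s
      = ∫ η, avg₃ r s f (status η (x, y)) (status η (x - 1, y + 1)) (status η (x - 2, y + 2))
          (status η (x - 3, y + 3)) ∂boardLaw r s := by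
  have hs : ∀ u z : ℤ × ℤ, z.1 ≠ u.1 → u.1 + u.2 ≤ z.1 + z.2 →
      Measurable[awayFrom u] fun η => status η z := fun u z hne hle =>
    measurable_status_awayFrom (fun h => hne (congrArg Prod.fst h)) hle
  have e₃ := integral_status_eq_avg h (x - 3, y + 2)
    (Z := fun η => (status η (x - 1, y), status η (x - 2, y + 1), status η (x - 2, y + 2),
      status η (x - 3, y + 3)))
    (a := fun t => t.2.2.1) (b := fun t => t.2.2.2)
    (by
      refine (hs _ _ ?_ ?_).prodMk ((hs _ _ ?_ ?_).prodMk ((hs _ _ ?_ ?_).prodMk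
        (measurable_status_awayFrom ?_ ?_))) <;> simp <;> omega)
    (fun η => by simp [step]; ring_nf) (fun η => by simp [step]; ring_nf)
    (fun t x₃ => f t.1 t.2.1 x₃)
  have e₂ := integral_status_eq_avg h (x - 2, y + 1)
    (Z := fun η => (status η (x - 1, y), status η (x - 1, y + 1), status η (x - 2, y + 2),
      status η (x - 3, y + 3)))
    (a := fun t => t.2.1) (b := fun t => t.2.2.1)
    (by
      refine (hs _ _ ?_ ?_).prodMk ((hs _ _ ?_ ?_).prodMk ((measurable_status_awayFrom ?_ ?_).prodMk
        (hs _ _ ?_ ?_))) <;> simp <;> omega)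
    (fun η => by simp [step]; ring_nf) (fun η => by simp [step]; ring_nf)
    (fun t x₂ => avg r s t.2.2.1 t.2.2.2 fun x₃ => f t.1 x₂ x₃)
  have e₁ := integral_status_eq_avg h (x - 1, y)
    (Z := fun η => (status η (x, y), status η (x - 1, y + 1), status η (x - 2, y + 2),
      status η (x - 3, y + 3)))
    (a := fun t => t.1) (b := fun t => t.2.1)
    (by
      refine (hs _ _ ?_ ?_).prodMk ((measurable_status_awayFrom ?_ ?_).prodMk ((hs _ _ ?_ ?_).prodMk
        (hs _ _ ?_ ?_))) <;> simp <;> omega)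
    (fun η => by simp [step]) (fun η => by simp [step])
    (fun t x₁ => avg r s t.2.1 t.2.2.1 fun x₂ => avg r s t.2.2.1 t.2.2.2 fun x₃ => f x₁ x₂ x₃)
  exact e₃.trans (e₂.trans e₁)

/-! ### The drift of a potential -/

/-- The decrease of the potential `w` in one step, on a window of four neighbouring positions,
corrected by the flux `g`. -/
def drift (r s : ℝ) (w g : Status → Status → Status → ℝ) (a b c d : Status) : ℝ :=
  w a b c - avg₃ r s w a b c d + g a b c - g b c d

theorem integrable_comp_status₄ {r s : ℝ} (h : (r, s) ∈ paramSpace)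
    (F : Status → Status → Status → Status → ℝ) (v₀ v₁ v₂ v₃ : ℤ × ℤ) :
    Integrable (fun η => F (status η v₀) (status η v₁) (status η v₂) (status η v₃))
      (boardLaw r s) := by
  have := isProbabilityMeasure_boardLaw h
  have hZ : Measurable fun η => (status η v₀, status η v₁, status η v₂, status η v₃) :=
    (measurable_status v₀).prodMk ((measurable_status v₁).prodMk
      ((measurable_status v₂).prodMk (measurable_status v₃)))
  have := Measure.isProbabilityMeasure_map (μ := boardLaw r s) hZ.aemeasurable
  exact (Integrable.of_finite (μ := (boardLaw r s).map _)
    (f := fun t : Status × Status × Status × Status => F t.1 t.2.1 t.2.2.1 t.2.2.2)).comp_measurable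
    hZ

/-- The translation by `(-1, 0)` matches the means of `w` on two consecutive antidiagonals; the one
by `(-1, 1)`, along the antidiagonal, cancels the flux. -/
theorem integral_drift {r s : ℝ} (h : (r, s) ∈ paramSpace)
    (w g : Status → Status → Status → ℝ) (x y : ℤ) :
    ∫ η, drift r s w g (status η (x, y)) (status η (x - 1, y + 1)) (status η (x - 2, y + 2))
      (status η (x - 3, y + 3)) ∂boardLaw r s = 0 := by
  have hI := integrable_comp_status₄ h
  have e₁ := integral_status_window h w x y
  have e₂ := integral_status_translate h w (x, y) (x - 1, y + 1) (x - 2, y + 2) (-1, 0)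
  have e₃ := integral_status_translate h g (x, y) (x - 1, y + 1) (x - 2, y + 2) (-1, 1)
  have hv : ∀ a : ℤ, ((x - 1, y + 1) : ℤ × ℤ) + (-1, a) = (x - 2, y + 1 + a) ∧
      ((x - 2, y + 2) : ℤ × ℤ) + (-1, a) = (x - 3, y + 2 + a) ∧
      ((x, y) : ℤ × ℤ) + (-1, a) = (x - 1, y + a) := fun a => by
    refine ⟨?_, ?_, ?_⟩ <;> ext <;> simp only [Prod.mk_add_mk] <;> ring
  rw [(hv 0).1, (hv 0).2.1, (hv 0).2.2] at e₂
  rw [(hv 1).1, (hv 1).2.1, (hv 1).2.2] at e₃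
  simp only [add_zero, add_assoc, show (1 : ℤ) + 1 = 2 by rfl, show (2 : ℤ) + 1 = 3 by rfl]
    at e₂ e₃
  unfold drift
  rw [integral_sub, integral_add, integral_sub, ← e₁, e₂, e₃]
  · ring
  · exact hI (fun a b c _ => w a b c) _ _ _ (x - 3, y + 3)
  · exact hI (avg₃ r s w) _ _ _ _
  · exact hI (fun a b c d => w a b c - avg₃ r s w a b c d) _ _ _ _
  · exact hI (fun a b c _ => g a b c) _ _ _ (x - 3, y + 3)
  · exact hI (fun a b c d => w a b c - avg₃ r s w a b c d + g a b c) _ _ _ _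
  · exact hI (fun _ b c d => g b c d) (x, y) _ _ _

/-- The reversed drift is again a drift, so its mean vanishes without any reflection of the board.
The extra `-w` in the flux moves the potential from one end of the window to the other. -/
theorem drift_reverse (r s : ℝ) (w g : Status → Status → Status → ℝ) (a b c d : Status) :
    drift r s w g d c b a
      = drift r s (fun x y z => w z y x) (fun x y z => -(g z y x) - w z y x) a b c d := by
  unfold drift
  rw [avg₃_reverse]
  ring

/-- If the symmetrized drift of some potential is nonnegative, and bounded away from zero where
the window starts with a draw, then there are almost surely no draws. -/
theorem drawProb_eq_zero_of_drift {r s κ : ℝ} (h : (r, s) ∈ paramSpace)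
    (w g : Status → Status → Status → ℝ) (hκ : 0 < κ)
    (hd : ∀ a b c d, (if a = Status.draw then κ else 0)
      ≤ drift r s w g a b c d + drift r s w g d c b a) (v : ℤ × ℤ) : drawProb r s v = 0 := by
  have := isProbabilityMeasure_boardLaw h
  obtain ⟨x, y⟩ := v
  have hS : MeasurableSet {η | status η (x, y) = Status.draw} :=
    measurable_status (x, y) (measurableSet_singleton Status.draw)
  have h₀ := integral_drift h w g x y
  have h₁ := integral_drift h (fun x y z => w z y x) (fun x y z => -(g z y x) - w z y x) x y
  simp only [← drift_reverse] at h₁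
  have hI := integrable_comp_status₄ h
  have hle := integral_mono
    (hI (fun a _ _ _ => if a = Status.draw then κ else 0) (x, y) (x - 1, y + 1) (x - 2, y + 2)
      (x - 3, y + 3))
    ((hI (drift r s w g) (x, y) (x - 1, y + 1) (x - 2, y + 2) (x - 3, y + 3)).add
      (hI (fun a b c d => drift r s w g d c b a) (x, y) (x - 1, y + 1) (x - 2, y + 2)
        (x - 3, y + 3)))
    (fun η => hd _ _ _ _)
  simp only [Pi.add_apply] at hle
  rw [integral_add (hI (drift r s w g) _ _ _ _) (hI (fun a b c d => drift r s w g d c b a) _ _ _ _),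
    h₀, h₁] at hle
  have e : ∫ η, (if status η (x, y) = Status.draw then κ else 0) ∂boardLaw r s
      = (boardLaw r s).real {η | status η (x, y) = Status.draw} * κ := by
    rw [← smul_eq_mul, ← integral_indicator_const κ hS]
    simp only [Set.indicator_apply, Set.mem_ofPred_eq]
  rw [e, add_zero] at hle
  have hz : (boardLaw r s).real {η | status η (x, y) = Status.draw} = 0 :=
    le_antisymm (by nlinarith) measureReal_nonneg
  rw [measureReal_eq_zero_iff] at hz
  exact measure_mono_null (fun η hη => status_eq_draw_of_isDraw hη) hz

/-! ### A family of potentials -/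

/-- The potential that gives weight `wD` to each draw, with additional weights for a draw followed
by a win, by a loss, and by a win and a loss. -/
def potential (wD wDW wDL wDWL : ℝ) : Status → Status → Status → ℝ
  | Status.draw, Status.win, Status.loss => wD + wDW + wDWL
  | Status.draw, Status.win, _ => wD + wDW
  | Status.draw, Status.loss, _ => wD + wDL
  | Status.draw, Status.draw, _ => wD
  | _, _, _ => 0

/-- A flux that is carried by the non-palindromic windows that contain a draw. -/
def flux (gLDW gDWW gDWL gDLW gDLL gDDW gDDL : ℝ) : Status → Status → Status → ℝ
  | Status.loss, Status.draw, Status.win => gLDW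
  | Status.draw, Status.win, Status.win => gDWW
  | Status.draw, Status.win, Status.loss => gDWL
  | Status.draw, Status.loss, Status.win => gDLW
  | Status.draw, Status.loss, Status.loss => gDLL
  | Status.draw, Status.draw, Status.win => gDDW
  | Status.draw, Status.draw, Status.loss => gDDL
  | _, _, _ => 0

/-- Given the successors the statuses are independent, so each pattern has a product probability;
statuses that a pattern leaves free sum to one. -/
theorem avg₃_potential (r s wD wDW wDL wDWL : ℝ) (a b c d : Status) :
    avg₃ r s (potential wD wDW wDL wDWL) a b c d
      = trans r s a b Status.draw * (wD + trans r s b c Status.loss * wDL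
        + trans r s b c Status.win * (wDW + trans r s c d Status.loss * wDWL)) := by
  have h : ∀ a b, trans r s a b Status.draw
      = 1 - trans r s a b Status.win - trans r s a b Status.loss := fun a b => by
    simp only [trans]
    ring
  simp only [avg₃, avg, potential, h c d, h b c]
  ring

theorem drift_potential_flux (r s wD wDW wDL wDWL gLDW gDWW gDWL gDLW gDLL gDDW gDDL : ℝ)
    (a b c d : Status) :
    drift r s (potential wD wDW wDL wDWL) (flux gLDW gDWW gDWL gDLW gDLL gDDW gDDL) a b c d
      = potential wD wDW wDL wDWL a b c
        - trans r s a b Status.draw * (wD + trans r s b c Status.loss * wDL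
          + trans r s b c Status.win * (wDW + trans r s c d Status.loss * wDWL))
        + flux gLDW gDWW gDWL gDLW gDLL gDDW gDDL a b c
        - flux gLDW gDWW gDWL gDLW gDLL gDDW gDDL b c d := by
  rw [drift, avg₃_potential]

/-! ### Explicit potentials and fluxes for the three parameter regions -/

set_option maxHeartbeats 4000000 in
/-- There are no draws if traps and targets have the same probability `s ≥ 0.10883`. -/
theorem drawProb_eq_zero_of_eq {s : ℝ} (h : (s, s) ∈ paramSpace) (hs : 0.10883 ≤ s)
    (v : ℤ × ℤ) : drawProb s s v = 0 := by
  have h₁ : s ≤ 1 / 2 := by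
    have := h.2.2.2
    simp only at this
    linarith
  have h₀ : 0 ≤ s - 108 / 1000 := by norm_num at hs; linarith
  have h₂ : 0 ≤ 1 / 2 - s := by linarith
  -- Bernstein products on `[0.108, 1/2]`. The drift has degree at most 6 in `s`, from three
  -- quadratic transition probabilities, and positivity is certified by nonnegative combinations of
  -- the products of degree 6.
  have hb : ∀ i j : ℕ, 0 ≤ (s - 108 / 1000) ^ i * (1 / 2 - s) ^ j := fun i j => by positivity
  -- For fixed `s` the window inequalities are linear in the weights and fluxes; these constants are
  -- a common solution for the whole interval.
  refine drawProb_eq_zero_of_drift h (potential 20 16 0 7)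
    (flux (-11) (-18) (-17) (-14) (-14) (-17) (-5)) (κ := 1 / 10) (by norm_num) (fun a b c d => ?_) v
  rw [drift_potential_flux, drift_potential_flux]
  cases a <;> cases b <;> cases c <;> cases d <;>
    simp only [potential, flux, trans, lossFactor, nonwinFactor, reduceCtorEq,
      if_true, if_false] <;>
    linarith [hb 0 6, hb 1 5, hb 2 4, hb 3 3, hb 4 2, hb 5 1, hb 6 0]

set_option maxHeartbeats 4000000 in
/-- There are no draws if there are no targets and traps have probability `r > 0.157175`. -/
theorem drawProb_eq_zero_of_trap {r : ℝ} (h : (r, 0) ∈ paramSpace) (hr : 0.157175 < r)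
    (v : ℤ × ℤ) : drawProb r 0 v = 0 := by
  have h₁ : r ≤ 1 := h.1.2
  have h₀ : 0 ≤ r - 157 / 1000 := by norm_num at hr; linarith
  have h₂ : 0 ≤ 1 - r := by linarith
  -- Bernstein products on `[0.157, 1]`, now of degree 7, because the weights are affine in `r`.
  have hb : ∀ i j : ℕ, 0 ≤ (r - 157 / 1000) ^ i * (1 - r) ^ j := fun i j => by positivity
  refine drawProb_eq_zero_of_drift h
    (potential 500 (595 - 6 * r) (113 + 908 * r) (430 - 1013 * r))
    (flux (-361 + 430 * r) (-459 + 17 * r) (-459 + 17 * r) (-649 + 400 * r) (-693 + 559 * r)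
      (-469 + 266 * r) (-11 - 361 * r))
    (κ := 1 / 10) (by norm_num) (fun a b c d => ?_) v
  rw [drift_potential_flux, drift_potential_flux]
  cases a <;> cases b <;> cases c <;> cases d <;>
    simp only [potential, flux, trans, lossFactor, nonwinFactor, reduceCtorEq,
      if_true, if_false] <;>
    linarith [hb 0 7, hb 1 6, hb 2 5, hb 3 4, hb 4 3, hb 5 2, hb 6 1, hb 7 0]

set_option maxHeartbeats 8000000 in
/-- There are no draws if the probability `s` of a target is small and that of a trap is at most
`4 * s ^ 2`. -/
theorem drawProb_eq_zero_of_le_sq {r s : ℝ} (h : (r, s) ∈ paramSpace) (hs₀ : 0 < s)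
    (hs : s ≤ 1 / 10 ^ 6) (hrs : r ≤ 4 * s ^ 2) (v : ℤ × ℤ) : drawProb r s v = 0 := by
  have hr₀ : 0 ≤ r := h.1.1
  have hs₁ : s ≤ 1 := h.2.1.2
  have hr₁ : r ≤ 1 := h.1.2
  have lo : ∀ i j : ℕ, 0 ≤ s ^ i * r ^ j := fun i j => by positivity
  have hsq : s ^ 2 ≤ s / 10 ^ 6 := by nlinarith
  have hcube : 4 * s ^ 3 ≤ s ^ 2 / 10 ^ 5 := by nlinarith [sq_nonneg s]
  -- Here `r` counts as a term of order `s ^ 2`, so every monomial of order at least 3 is negligible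
  -- against `s ^ 2`.
  have up : ∀ i j : ℕ, 3 ≤ i + 2 * j → s ^ i * r ^ j ≤ s ^ 2 / 10 ^ 5 := fun i j hij => by
    refine le_trans ?_ hcube
    rcases j with _ | _ | j
    · have := pow_le_pow_of_le_one hs₀.le hs₁ (show 3 ≤ i by omega)
      rw [pow_zero, mul_one]
      linarith [pow_pos hs₀ 3]
    · have := pow_le_pow_of_le_one hs₀.le hs₁ (show 1 ≤ i by omega)
      calc s ^ i * r ^ (0 + 1) ≤ s ^ 1 * (4 * s ^ 2) := by
            rw [zero_add, pow_one r]; gcongr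
        _ = 4 * s ^ 3 := by ring
    · have h₂ := pow_le_pow_of_le_one hr₀ hr₁ (show 2 ≤ j + 1 + 1 by omega)
      calc s ^ i * r ^ (j + 1 + 1) ≤ 1 * r ^ 2 := by
            gcongr
            exact pow_le_one₀ hs₀.le hs₁
        _ ≤ (4 * s ^ 2) ^ 2 := by rw [one_mul]; gcongr
        _ = 4 * s ^ 3 * (4 * s) := by ring
        _ ≤ 4 * s ^ 3 * 1 := by gcongr; linarith
        _ = 4 * s ^ 3 := mul_one _
  -- The weights are expansions to second order in `s`; only the monomials `1`, `s`, `s ^ 2` and `r`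
  -- of the drift then have to be controlled exactly.
  refine drawProb_eq_zero_of_drift h
    (potential 1 (1 - 5 * s ^ 2) (-4 * s + 18 * s ^ 2) (1 - 4 * s + 2 * s ^ 2))
    (flux (-1 + 7 * s ^ 2) (-1 - 2 * s + 20 * s ^ 2) (-1 + s ^ 2) (-1 + 4 * s - 5 * s ^ 2)
      (-1 + 4 * s - 9 * s ^ 2) (-1 + 3 * s ^ 2) (-5 * s ^ 2))
    (κ := s ^ 2 / 10) (by positivity) (fun a b c d => ?_) v
  rw [drift_potential_flux, drift_potential_flux]
  cases a <;> cases b <;> cases c <;> cases d <;>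
    simp only [potential, flux, trans, lossFactor, nonwinFactor, reduceCtorEq,
      if_true, if_false] <;>
    linarith [lo 3 0, up 3 0 (by norm_num), lo 4 0, up 4 0 (by norm_num), lo 5 0, up 5 0 (by
      norm_num), lo 6 0, up 6 0 (by norm_num), lo 7 0, up 7 0 (by norm_num), lo 8 0, up 8 0
      (by norm_num), lo 1 1, up 1 1 (by norm_num), lo 2 1, up 2 1 (by norm_num), lo 3 1, up
      3 1 (by norm_num), lo 4 1, up 4 1 (by norm_num), lo 5 1, up 5 1 (by norm_num), lo 6 1,
      up 6 1 (by norm_num), lo 7 1, up 7 1 (by norm_num), lo 0 2, up 0 2 (by norm_num), lo 1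
      2, up 1 2 (by norm_num), lo 2 2, up 2 2 (by norm_num), lo 3 2, up 3 2 (by norm_num),
      lo 4 2, up 4 2 (by norm_num), lo 5 2, up 5 2 (by norm_num), lo 6 2, up 6 2 (by
      norm_num), lo 0 3, up 0 3 (by norm_num), lo 1 3, up 1 3 (by norm_num), lo 2 3, up 2 3
      (by norm_num), lo 3 3, up 3 3 (by norm_num), lo 4 3, up 4 3 (by norm_num), lo 5 3, up
      5 3 (by norm_num), lo 0 4, up 0 4 (by norm_num), lo 1 4, up 1 4 (by norm_num), lo 2 4,
      up 2 4 (by norm_num), lo 3 4, up 3 4 (by norm_num), lo 4 4, up 4 4 (by norm_num), lo 0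
      5, up 0 5 (by norm_num), lo 1 5, up 1 5 (by norm_num), lo 2 5, up 2 5 (by norm_num),
      lo 3 5, up 3 5 (by norm_num), lo 0 6, up 0 6 (by norm_num), lo 1 6, up 1 6 (by
      norm_num), lo 2 6, up 2 6 (by norm_num)]

theorem pos_and_le_sq_of_le {r s : ℝ} (h : (r, s) ∈ paramSpace) (hr : r ≤ 1 / 10 ^ 6)
    (hs : s ≤ 1 / 10 ^ 6)
    (hrs : 3 * (2 * s - s ^ 2) ^ 2 / 2 + 8 * (2 * s - s ^ 2) * r / (1 - s)
            + 11 * r ^ 2 / (2 * (1 - s) ^ 2)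
          ≥ 2 * r / (1 - s) + 9 * (2 * s - s ^ 2) ^ 3 / 2
            + 16 * (2 * s - s ^ 2) ^ 2 * r / (1 - s)
            + 43 * (2 * s - s ^ 2) * r ^ 2 / (2 * (1 - s) ^ 2)
            + 5 * r ^ 3 / (1 - s) ^ 3) : 0 < s ∧ r ≤ 4 * s ^ 2 := by
  obtain ⟨⟨hr₀, -⟩, ⟨hs₀, -⟩, hpos, -⟩ := h
  simp only at hr₀ hs₀ hpos
  have h1s : 0 < 1 - s := by norm_num at hs; linarith
  -- In terms of `p` and `q` the assumption becomes a polynomial inequality whose leading terms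
  -- compare `2 * q` with `3 * p ^ 2 / 2`.
  obtain ⟨q, hq⟩ : ∃ q, q = r / (1 - s) := ⟨_, rfl⟩
  obtain ⟨p, hp⟩ : ∃ p, p = 2 * s - s ^ 2 := ⟨_, rfl⟩
  have hrq : r = q * (1 - s) := by rw [hq]; field_simp
  have hq₀ : 0 ≤ q := hq ▸ div_nonneg hr₀ h1s.le
  have hp₀ : 0 ≤ p := by rw [hp]; nlinarith
  have hp₂ : p ≤ 2 * s := by rw [hp]; nlinarith
  have hrle : r ≤ q := by rw [hrq]; nlinarith
  have hq₂ : q ≤ 2 * r := by rw [hrq]; norm_num at hs; nlinarith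
  have key : 3 * p ^ 2 / 2 + 8 * p * q + 11 * q ^ 2 / 2
      ≥ 2 * q + 9 * p ^ 3 / 2 + 16 * p ^ 2 * q + 43 * p * q ^ 2 / 2 + 5 * q ^ 3 := by
    rw [← hp] at hrs
    convert hrs using 1 <;> rw [hq] <;> field_simp
  have hsmall : 8 * p + 11 * q / 2 ≤ 1 / 10 := by norm_num at hs hr; linarith
  -- The cubic terms are dropped, and `8 * p * q + 11 * q ^ 2 / 2` costs at most `q / 10` of the
  -- term `2 * q`. As `p ≤ 2 * s`, this gives `q ≤ 60 / 19 * s ^ 2`.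
  have hqp : 19 / 10 * q ≤ 3 / 2 * p ^ 2 := by
    have h₁ : 0 ≤ 9 * p ^ 3 / 2 + 16 * p ^ 2 * q + 43 * p * q ^ 2 / 2 + 5 * q ^ 3 := by positivity
    have h₂ := mul_le_mul_of_nonneg_left hsmall hq₀
    linarith
  have hr4 : r ≤ 4 * s ^ 2 := by
    have : p ^ 2 ≤ (2 * s) ^ 2 := pow_le_pow_left₀ hp₀ hp₂ 2
    linarith
  -- If `s = 0`, the bound just proved forces `r ≤ 0`, against `0 < r + s`.
  refine ⟨lt_of_le_of_ne hs₀ fun hs0 => ?_, hr4⟩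
  rw [← hs0] at hr4 hpos
  linarith

end BondGame

theorem theorem2 :
    (∃ ε₁ ∈ Set.Ioo (0 : ℝ) 1, ∃ ε₂ ∈ Set.Ioo (0 : ℝ) 1,
      ∀ r s : ℝ, (r, s) ∈ BondGame.paramSpace → r ≤ ε₁ → s ≤ ε₂ →
        3 * (2 * s - s ^ 2) ^ 2 / 2 + 8 * (2 * s - s ^ 2) * r / (1 - s)
            + 11 * r ^ 2 / (2 * (1 - s) ^ 2)
          ≥ 2 * r / (1 - s) + 9 * (2 * s - s ^ 2) ^ 3 / 2
            + 16 * (2 * s - s ^ 2) ^ 2 * r / (1 - s)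
            + 43 * (2 * s - s ^ 2) * r ^ 2 / (2 * (1 - s) ^ 2)
            + 5 * r ^ 3 / (1 - s) ^ 3 →
        ∀ v : ℤ × ℤ, BondGame.drawProb r s v = 0) ∧
    (∀ r s : ℝ, (r, s) ∈ BondGame.paramSpace → s = 0 → 0.157175 < r →
      ∀ v : ℤ × ℤ, BondGame.drawProb r s v = 0) ∧
    (∀ r s : ℝ, (r, s) ∈ BondGame.paramSpace → r = s → 0.10883 ≤ r →
      ∀ v : ℤ × ℤ, BondGame.drawProb r s v = 0) := by
  refine ⟨⟨1 / 10 ^ 6, by norm_num, 1 / 10 ^ 6, by norm_num, fun r s h hr hs hrs v => ?_⟩, ?_, ?_⟩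
  · obtain ⟨hs₀, hrs'⟩ := BondGame.pos_and_le_sq_of_le h hr hs hrs
    exact BondGame.drawProb_eq_zero_of_le_sq h hs₀ hs hrs' v
  · rintro r s h rfl hr v
    exact BondGame.drawProb_eq_zero_of_trap h hr v
  · rintro r s h rfl hr v
    exact BondGame.drawProb_eq_zero_of_eq h hr v
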